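/- Fix a natural number $d\ge 3$. Let $Q$ be a Euclidean ordered field, that is, a linearly ordered field in which every positive element has a square root. For $\vec p=\langle p_1,\dots,p_d\rangle\in Q^d$ write $p_\tau:=p_1$ and $\vec p_\sigma:=\langle p_2,\dots,p_d\rangle$, let $|\vec x|:=\sqrt{x_1^2+\dots+x_n^2}$ for $\vec x\in Q^n$, and let $$\mu(\vec p):=\begin{cases}\sqrt{p_\tau^2-|\vec p_\sigma|^2}&\text{if }p_\tau^2\ge|\vec p_\sigma|^2,\\-\sqrt{|\vec p_\sigma|^2-p_\tau^2}&\text{otherwise.}\end{cases}$$ Let $\mathrm B$ be a set (of bodies) with subsets $\mathrm{IOb}\subseteq\mathrm{Ob}\subseteq\mathrm B$ (inertial observers, observers) and $\mathrm{Ph}\subseteq\mathrm B$ (photons), and let $\mathrm W\subseteq\mathrm{Ob}\times\mathrm B\times Q^d$ (the world-view relation). For $m\in\mathrm{Ob}$ and $\vec p\in Q^d$ put $ev_m(\vec p):=\{b\in\mathrm B:\mathrm W(m,b,\vec p)\}$, $Cd_m:=\{\vec p\in Q^d: ev_m(\vec p)\ne\emptyset\}$ and $Ev_m:=\{ev_m(\vec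 p):\vec p\in Cd_m\}$. If there is a unique $\vec p\in Cd_m$ with $ev_m(\vec p)=e$, this $\vec p$ is denoted $Crd_m(e)$. Events $e_1,e_2$ are simultaneous for $m$, written $e_1\sim_m e_2$, if $Crd_m(e_1)$ and $Crd_m(e_2)$ exist and $Crd_m(e_1)_\tau=Crd_m(e_2)_\tau$; and $\mathsf{dist}_m(e_1,e_2):=|Crd_m(e_1)_\sigma-Crd_m(e_2)_\sigma|$. The world-view transformation is the binary relation $$w^k_m:=\{\langle\vec q,\vec p\rangle\in Cd_k\times Cd_m: ev_k(\vec q)=ev_m(\vec p)\}.$$ Consider the axioms - $\mathrm{AxPh}_0$: for all $m\in\mathrm{IOb}$ and $\vec p,\vec q\in Q^d$: $|\vec p_\sigma-\vec q_\sigma|=|p_\tau-q_\tau|$ if and only if $\mathrm{Ph}\cap ev_m(\vec p)\cap ev_m(\vec q)\neq\emptyset$; - $\mathrm{AxEv}$: $Ev_m=Ev_k$ for all $m,k\in\mathrm{IOb}$; - $\mathrm{AxSimDist}$: for all $m,k\in\mathrm{IOb}$ and $e_1,e_2\in Ev_m\cap Ev_k$, if $e_1\sim_m e_2$ and $e_1\sim_k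 e_2$, then $\mathsf{dist}_m(e_1,e_2)=\mathsf{dist}_k(e_1,e_2)$. A Poincaré transformation is an affine transformation $P:Q^d\to Q^d$ with $\mu(P(\vec p)-P(\vec q))=\mu(\vec p-\vec q)$ for all $\vec p,\vec q$. A dilation is a map $\vec p\mapsto\lambda\vec p$ with $\lambda\in Q$, $\lambda>0$. A field-automorphism induced map is a map $\tilde\varphi(\vec p)=\langle\varphi(p_1),\dots,\varphi(p_d)\rangle$, where $\varphi$ is an automorphism of the field $Q$. **Theorem.** Let $m,k\in\mathrm{IOb}$. 1. If $\mathrm{AxPh}_0$ and $\mathrm{AxEv}$ hold, then $w^k_m$ is (the graph of) a map $Q^d\to Q^d$ of the form $\vec q\mapsto P(D(\tilde\varphi(\vec q)))$, where $P$ is a Poincaré transformation, $D$ a dilation and $\tilde\varphi$ a field-automorphism induced map. 2. If $\mathrm{AxPh}_0$, $\mathrm{AxEv}$ and $\mathrm{AxSimDist}$ hold, then $w^k_m$ is (the graph of) a Poincaré transformation. -/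

import Mathlib

namespace SpecRel

/-- A linearly ordered field is Euclidean if its positive elements have square roots. -/
class IsEuclideanField (Q : Type*) [Field Q] [LinearOrder Q] [IsStrictOrderedRing Q] : Prop where
  exists_sq : ∀ x : Q, 0 < x → ∃ y : Q, y ^ 2 = x

section Field

variable {Q : Type*} [Field Q] [LinearOrder Q] [IsStrictOrderedRing Q]

open Classical in
/-- The nonnegative square root; it is only applied to nonnegative elements of a Euclidean field
(the value is `0` where there is no root). -/
noncomputable def sqrt (x : Q) : Q :=
  if h : ∃ y : Q, 0 ≤ y ∧ y ^ 2 = x then h.choose else 0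

theorem sqrt_nonneg (x : Q) : 0 ≤ sqrt x := by
  unfold sqrt
  split_ifs with h
  · exact h.choose_spec.1
  · exact le_rfl

theorem sq_sqrt [IsEuclideanField Q] {x : Q} (hx : 0 ≤ x) : sqrt x ^ 2 = x := by
  have h : ∃ y : Q, 0 ≤ y ∧ y ^ 2 = x := by
    rcases hx.eq_or_lt with rfl | hx
    · exact ⟨0, le_rfl, by simp⟩
    · obtain ⟨y, hy⟩ := IsEuclideanField.exists_sq x hx
      exact ⟨|y|, abs_nonneg y, by rw [sq_abs, hy]⟩
  unfold sqrt
  rw [dif_pos h]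
  exact h.choose_spec.2

/-- The Euclidean length of a tuple of quantities. -/
noncomputable def euclLength {ι : Type*} [Fintype ι] (p : ι → Q) : Q :=
  sqrt (∑ i, p i ^ 2)

variable {d : ℕ} [NeZero d]

/-- The time component: the first coordinate. -/
def timeComp (p : Fin d → Q) : Q := p 0

/-- The space component: all coordinates but the first. -/
def spaceComp (p : Fin d → Q) : {i : Fin d // i ≠ 0} → Q := fun i => p i

/-- The signed Minkowski length. -/
noncomputable def minkLength (p : Fin d → Q) : Q :=
  if euclLength (spaceComp p) ^ 2 ≤ timeComp p ^ 2 then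
    sqrt (timeComp p ^ 2 - euclLength (spaceComp p) ^ 2)
  else
    -sqrt (euclLength (spaceComp p) ^ 2 - timeComp p ^ 2)

/-- The Minkowski distance. -/
noncomputable def minkDist (p q : Fin d → Q) : Q := minkLength (p - q)

/-- Poincaré transformations: affine transformations preserving the Minkowski distance. -/
def IsPoincare (f : (Fin d → Q) → (Fin d → Q)) : Prop :=
  (∃ A : (Fin d → Q) ≃ᵃ[Q] (Fin d → Q), ∀ p, f p = A p) ∧
    ∀ p q, minkDist (f p) (f q) = minkDist p q

/-- Dilations: multiplications by a positive quantity. -/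
def IsDilation (f : (Fin d → Q) → (Fin d → Q)) : Prop :=
  ∃ c : Q, 0 < c ∧ ∀ p, f p = c • p

/-- Maps induced by an automorphism of the field of quantities, acting coordinatewise. -/
def IsFieldAutInduced (f : (Fin d → Q) → (Fin d → Q)) : Prop :=
  ∃ φ : Q ≃+* Q, ∀ p i, f p i = φ (p i)

end Field

/-- The (non-quantity part of the) models of the language, with bodies forming the sort `B` and
quantities the sort `Q`: observers, inertial observers, photons, and the world-view relation
`W m b p`, "observer `m` coordinatizes body `b` at the coordinate point `p`". -/
structure Model (Q : Type*) (d : ℕ) (B : Type*) where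
  Ob : Set B
  IOb : Set B
  Ph : Set B
  W : B → B → (Fin d → Q) → Prop
  iob_subset_ob : IOb ⊆ Ob
  ob_of_W : ∀ m b p, W m b p → m ∈ Ob

namespace Model

section Basic

variable {Q : Type*} {d : ℕ} {B : Type*} (M : Model Q d B)

/-- The event observed by `m` at `p`. -/
def ev (m : B) (p : Fin d → Q) : Set B := {b | M.W m b p}

/-- The coordinate-domain of `m`. -/
def Cd (m : B) : Set (Fin d → Q) := {p | M.ev m p ≠ ∅}

/-- The set of nonempty events observed by `m`. -/
def Ev (m : B) : Set (Set B) := {e | ∃ p, M.ev m p ≠ ∅ ∧ M.ev m p = e}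

/-- `p` is the unique coordinate point of the event `e` according to `m`. -/
def IsCrd (m : B) (e : Set B) (p : Fin d → Q) : Prop :=
  (p ∈ M.Cd m ∧ M.ev m p = e) ∧ ∀ q ∈ M.Cd m, M.ev m q = e → q = p

/-- The world-view transformation between the coordinate-domains of `k` and `m`,
as a binary relation. -/
def worldView (k m : B) (q p : Fin d → Q) : Prop :=
  q ∈ M.Cd k ∧ p ∈ M.Cd m ∧ M.ev k q = M.ev m p

/-- Inertial observers coordinatize the same events. -/
def AxEv : Prop := ∀ m ∈ M.IOb, ∀ k ∈ M.IOb, M.Ev m = M.Ev k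

end Basic

section Field

variable {Q : Type*} [Field Q] [LinearOrder Q] [IsStrictOrderedRing Q] {d : ℕ} [NeZero d]
  {B : Type*} (M : Model Q d B)

/-- For inertial observers there is a photon through two coordinate points iff their difference
has slope `1`. -/
def AxPh0 : Prop :=
  ∀ m ∈ M.IOb, ∀ p q : Fin d → Q,
    euclLength (spaceComp p - spaceComp q) = |timeComp p - timeComp q| ↔
      M.Ph ∩ M.ev m p ∩ M.ev m q ≠ ∅

/-- The events `e₁` and `e₂` are simultaneous for `m`
(in particular, both have unique coordinates). -/
def Simultaneous (m : B) (e₁ e₂ : Set B) : Prop :=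
  ∃ p₁ p₂, M.IsCrd m e₁ p₁ ∧ M.IsCrd m e₂ p₂ ∧ timeComp p₁ = timeComp p₂

/-- The spatial distance of `e₁` and `e₂` according to `m` is defined and equals `r`. -/
def IsSpatialDist (m : B) (e₁ e₂ : Set B) (r : Q) : Prop :=
  ∃ p₁ p₂, M.IsCrd m e₁ p₁ ∧ M.IsCrd m e₂ p₂ ∧ r = euclLength (spaceComp p₁ - spaceComp p₂)

/-- If two events are simultaneous for two inertial observers, then these agree on the spatial
distance of the events. -/
def AxSimDist : Prop :=
  ∀ m ∈ M.IOb, ∀ k ∈ M.IOb, ∀ e₁ ∈ M.Ev m ∩ M.Ev k, ∀ e₂ ∈ M.Ev m ∩ M.Ev k,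
    M.Simultaneous m e₁ e₂ → M.Simultaneous k e₁ e₂ →
      ∃ r : Q, M.IsSpatialDist m e₁ e₂ r ∧ M.IsSpatialDist k e₁ e₂ r

end Field

end Model

end SpecRel

set_option linter.unusedSectionVars false

/-! Under `AxPh0` every point has a nonempty event and distinct points have distinct events; with
`AxEv` the world-view relation is therefore the graph of a bijection `f` of `Q^d`. Photons turn into
the statement that `f` and its inverse preserve nullity of differences, so part 1 is the
Alexandrov–Zeeman theorem over a Euclidean field (`PreservesNull.exists_decomposition`).

Its proof recovers structure from nullity alone. Pairing nontrivially with a lightlike direction can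
be expressed by unique existence of null-related points (`existsUnique_isNull_iff`), so `f` respects
it. Hence parallel lightlike lines go to parallel lines and suitable lightlike parallelograms to
parallelograms; as null vectors generate `Q^d` additively, `f` is additive up to translation. On a
plane containing the time axis, a null vector leaving that plane forces the scaling of null
directions to be multiplicative, which gives semilinearity over a field automorphism `φ`. The
remaining linear factor preserves the cone, so it multiplies the form by some `c > 0`: a Poincaré
map after dilation by `√c`.

For part 2, some line is simultaneous for both observers. `AxSimDist` along it forces `φ(t)² = t²`
for all `t`, so `φ = id`, and then `c = 1`. -/

namespace SpecRel

/-! ### The Minkowski form and its null vectors. -/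

section Form

variable {Q : Type*} [Field Q] [LinearOrder Q] [IsStrictOrderedRing Q] {d : ℕ} [NeZero d]

variable (Q d) in
/-- The Minkowski bilinear form, of signature `(1, d - 1)`. -/
def minkForm : (Fin d → Q) →ₗ[Q] (Fin d → Q) →ₗ[Q] Q :=
  LinearMap.mk₂ Q (fun x y => x 0 * y 0 - ∑ i : {i : Fin d // i ≠ 0}, x i * y i)
    (fun x y z => by simp only [Pi.add_apply, add_mul, Finset.sum_add_distrib]; ring)
    (fun c x y => by
      simp only [Pi.smul_apply, smul_eq_mul, mul_assoc, ← Finset.mul_sum]; ring)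
    (fun x y z => by simp only [Pi.add_apply, mul_add, Finset.sum_add_distrib]; ring)
    (fun c x y => by
      simp only [Pi.smul_apply, smul_eq_mul, mul_left_comm _ c, ← Finset.mul_sum]; ring)

theorem minkForm_apply (x y : Fin d → Q) :
    minkForm Q d x y = x 0 * y 0 - ∑ i : {i : Fin d // i ≠ 0}, x i * y i := rfl

theorem minkForm_comm (x y : Fin d → Q) : minkForm Q d x y = minkForm Q d y x := by
  simp only [minkForm_apply, mul_comm]

theorem minkForm_self (x : Fin d → Q) :
    minkForm Q d x x = x 0 ^ 2 - ∑ i : {i : Fin d // i ≠ 0}, x i ^ 2 := by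
  simp only [minkForm_apply, sq]

theorem minkForm_single_zero (x : Fin d → Q) (t : Q) :
    minkForm Q d x (Pi.single 0 t) = x 0 * t := by
  rw [minkForm_apply, Finset.sum_eq_zero]
  · simp
  · rintro ⟨i, hi⟩ -
    simp [hi]

theorem minkForm_single {j : Fin d} (hj : j ≠ 0) (x : Fin d → Q) (t : Q) :
    minkForm Q d x (Pi.single j t) = -(x j * t) := by
  rw [minkForm_apply, Finset.sum_eq_single ⟨j, hj⟩]
  · simp [hj.symm]
  · rintro ⟨i, hi⟩ - h
    have : i ≠ j := fun h' => h (Subtype.ext h')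
    simp [this]
  · simp

/-- Lightlike or zero vectors. -/
def IsNull (x : Fin d → Q) : Prop := minkForm Q d x x = 0

theorem minkForm_self_nonpos {x : Fin d → Q} (h0 : x 0 = 0) : minkForm Q d x x ≤ 0 := by
  rw [minkForm_self, h0]
  have : 0 ≤ ∑ i : {i : Fin d // i ≠ 0}, x i ^ 2 := Finset.sum_nonneg fun i _ => sq_nonneg _
  linarith [zero_pow (M₀ := Q) two_ne_zero]

theorem IsNull.eq_zero {x : Fin d → Q} (hx : IsNull x) (h0 : x 0 = 0) : x = 0 := by
  rw [IsNull, minkForm_self, h0, zero_pow two_ne_zero, zero_sub, neg_eq_zero,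
    Finset.sum_eq_zero_iff_of_nonneg (fun i _ => sq_nonneg _)] at hx
  funext i
  by_cases hi : i = 0
  · simp [hi, h0]
  · exact pow_eq_zero_iff two_ne_zero |>.1 (hx ⟨i, hi⟩ (Finset.mem_univ _))

theorem isNull_zero : IsNull (0 : Fin d → Q) := by simp [IsNull]

theorem IsNull.smul {x : Fin d → Q} (hx : IsNull x) (t : Q) : IsNull (t • x) := by
  rw [IsNull] at *
  simp [hx]

theorem IsNull.neg {x : Fin d → Q} (hx : IsNull x) : IsNull (-x) := by
  rw [IsNull] at *
  simp [hx]

theorem minkForm_add_self (x y : Fin d → Q) :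
    minkForm Q d (x + y) (x + y) =
      minkForm Q d x x + 2 * minkForm Q d x y + minkForm Q d y y := by
  simp only [map_add, LinearMap.add_apply, minkForm_comm y x]
  ring

theorem minkForm_sub_self (x y : Fin d → Q) :
    minkForm Q d (x - y) (x - y) =
      minkForm Q d x x - 2 * minkForm Q d x y + minkForm Q d y y := by
  simp only [map_sub, LinearMap.sub_apply, minkForm_comm y x]
  ring

/-- Subtracting the multiple of `v` with the same time component as `w` leaves a null vector of time
component `0`, which must vanish. -/
theorem IsNull.exists_smul {v w : Fin d → Q} (hv : IsNull v) (hw : IsNull w) (hv0 : v ≠ 0)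
    (h : minkForm Q d v w = 0) : ∃ t : Q, w = t • v := by
  have h0 : v 0 ≠ 0 := fun h0 => hv0 (hv.eq_zero h0)
  refine ⟨w 0 / v 0, sub_eq_zero.1 (IsNull.eq_zero ?_ ?_)⟩
  · rw [IsNull] at *
    rw [minkForm_sub_self]
    simp [hv, hw, h, minkForm_comm w v]
  · simp [h0]

theorem IsNull.exists_smul_of_sub {v w : Fin d → Q} (hv : IsNull v) (hw : IsNull w) (hv0 : v ≠ 0)
    (h : IsNull (w - v)) : ∃ t : Q, w = t • v := by
  refine hv.exists_smul hw hv0 ?_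
  rw [IsNull] at *
  rw [minkForm_sub_self, hv, hw, minkForm_comm] at h
  linarith

theorem isNull_single_add {i : Fin d} (hi : i ≠ 0) (t : Q) {σ : Q} (hσ : σ ^ 2 = 1) :
    IsNull (Pi.single 0 t + Pi.single i (σ * t) : Fin d → Q) := by
  rw [IsNull, minkForm_add_self, minkForm_single_zero, minkForm_single hi, minkForm_single hi]
  simp [hi]
  linear_combination (-t ^ 2) * hσ

theorem mem_of_forall_single (S : AddSubgroup (Fin d → Q))
    (h : ∀ i t, (Pi.single i t : Fin d → Q) ∈ S) (x : Fin d → Q) : x ∈ S := by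
  rw [← Finset.univ_sum_single x]
  exact S.sum_mem fun i _ => h i _

/-- An additive subgroup is everything if it contains, for some `j` and for each `i`, enough of the
null vectors in the coordinate planes. -/
theorem mem_of_null_mem (S : AddSubgroup (Fin d → Q)) {j : Fin d}
    (hj : ∀ t, (Pi.single 0 t + Pi.single j t : Fin d → Q) ∈ S)
    (hj' : ∀ t, (Pi.single 0 t + Pi.single j (-t) : Fin d → Q) ∈ S)
    (h : ∀ i, i ≠ 0 → ∃ σ : Q, σ ^ 2 = 1 ∧
      ∀ t, (Pi.single 0 t + Pi.single i (σ * t) : Fin d → Q) ∈ S) (x : Fin d → Q) : x ∈ S := by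
  have h0 : ∀ t, (Pi.single 0 t : Fin d → Q) ∈ S := fun t => by
    have := S.add_mem (hj (t / 2)) (hj' (t / 2))
    rw [add_add_add_comm, ← Pi.single_add, ← Pi.single_add] at this
    simpa using this
  refine mem_of_forall_single S (fun i t => ?_) x
  by_cases hi : i = 0
  · rw [hi]; exact h0 t
  · obtain ⟨σ, hσ, hS⟩ := h i hi
    have := S.sub_mem (hS (σ * t)) (h0 (σ * t))
    rw [add_sub_cancel_left] at this
    rwa [← mul_assoc, ← sq, hσ, one_mul] at this

theorem exists_two_spatial (hd : 3 ≤ d) : ∃ i j : Fin d, i ≠ 0 ∧ j ≠ 0 ∧ i ≠ j := by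
  refine ⟨⟨1, by omega⟩, ⟨2, by omega⟩, ?_, ?_, ?_⟩ <;> simp [Fin.ext_iff]

theorem exists_spatial_ne (hd : 3 ≤ d) (i : Fin d) : ∃ j : Fin d, j ≠ 0 ∧ j ≠ i := by
  obtain ⟨a, b, ha, hb, hab⟩ := exists_two_spatial hd
  by_cases h : a = i
  · exact ⟨b, hb, fun h' => hab (h.trans h'.symm)⟩
  · exact ⟨a, ha, h⟩

/-- On a lightlike line there is a unique point lightlike related to `a` iff `a` is not in the
orthogonal hyperplane of the line. -/
theorem existsUnique_isNull_iff {q q' : Fin d → Q} (hq : IsNull (q' - q)) (hne : q' ≠ q)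
    (a : Fin d → Q) :
    (∃! r, IsNull (r - q) ∧ IsNull (r - q') ∧ IsNull (r - a)) ↔
      minkForm Q d (a - q) (q' - q) ≠ 0 := by
  set v := q' - q with hv
  have hv0 : v ≠ 0 := sub_ne_zero.2 hne
  -- As `v` is null the quadratic term in `t` drops out: nullity is an affine condition with slope
  -- `-2⟨a - q, v⟩`.
  have key : ∀ t : Q, minkForm Q d (q + t • v - a) (q + t • v - a) =
      minkForm Q d (a - q) (a - q) - 2 * t * minkForm Q d (a - q) v := by
    intro t
    have e : q + t • v - a = t • v - (a - q) := by abel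
    rw [e, minkForm_sub_self, minkForm_comm _ (a - q)]
    rw [IsNull] at hq
    simp only [map_smul, LinearMap.smul_apply, hq, smul_eq_mul]
    ring
  have on1 : ∀ t : Q, IsNull (q + t • v - q) := fun t => by
    rw [add_sub_cancel_left]; exact hq.smul t
  have on2 : ∀ t : Q, IsNull (q + t • v - q') := fun t => by
    have : q + t • v - q' = (t - 1) • v := by rw [sub_smul, one_smul, hv]; abel
    rw [this]; exact hq.smul _
  have line : ∀ r, IsNull (r - q) → IsNull (r - q') → ∃ t : Q, r = q + t • v := by
    intro r h1 h2
    obtain ⟨t, ht⟩ := hq.exists_smul_of_sub h1 hv0 (by rw [hv, sub_sub_sub_cancel_right]; exact h2)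
    exact ⟨t, by rw [← ht]; abel⟩
  constructor
  · rintro ⟨r, ⟨h1, h2, h3⟩, hu⟩ h0
    obtain ⟨t, rfl⟩ := line r h1 h2
    -- With slope zero, one solution makes every point of the line a solution.
    have h4 : IsNull (q + (t + 1) • v - a) := by
      rw [IsNull, key, h0] at *
      simpa using h3
    have := hu _ ⟨on1 _, on2 _, h4⟩
    apply hv0
    simpa [add_smul] using this
  · intro h0
    refine ⟨q + (minkForm Q d (a - q) (a - q) / (2 * minkForm Q d (a - q) v)) • v,
      ⟨on1 _, on2 _, ?_⟩, ?_⟩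
    · rw [IsNull, key]
      field_simp
      ring
    · rintro r ⟨h1, h2, h3⟩
      obtain ⟨t, rfl⟩ := line r h1 h2
      rw [IsNull, key] at h3
      congr 2
      field_simp
      linarith

end Form

/-! ### Null-preserving bijections are additive up to translation. -/

section Alexandrov

variable {Q : Type*} [Field Q] [LinearOrder Q] [IsStrictOrderedRing Q] {d : ℕ} [NeZero d]

/-- The bijections preserving the relation of being lightlike related in both directions. -/
def PreservesNull (f : (Fin d → Q) ≃ (Fin d → Q)) : Prop :=
  ∀ p q, IsNull (f p - f q) ↔ IsNull (p - q)

variable {f : (Fin d → Q) ≃ (Fin d → Q)}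

theorem PreservesNull.isNull_sub (hf : PreservesNull f) {v : Fin d → Q} (hv : IsNull v)
    (p : Fin d → Q) : IsNull (f (p + v) - f p) := by
  rw [hf]; simpa using hv

theorem apply_add_sub_ne_zero {v : Fin d → Q} (hv0 : v ≠ 0) (p : Fin d → Q) :
    f (p + v) - f p ≠ 0 := by
  rw [sub_ne_zero, f.injective.ne_iff]; simpa using hv0

/-- The unique-existence criterion mentions only null differences, so `f` transports it. -/
theorem PreservesNull.minkForm_ne_zero_iff (hf : PreservesNull f) {v : Fin d → Q} (hv : IsNull v)
    (hv0 : v ≠ 0) (q a : Fin d → Q) :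
    minkForm Q d (f a - f q) (f (q + v) - f q) ≠ 0 ↔ minkForm Q d (a - q) v ≠ 0 := by
  have h2 := existsUnique_isNull_iff (q := q) (q' := q + v) (by simpa using hv)
    (by simpa using hv0) a
  rw [← existsUnique_isNull_iff (hf.isNull_sub hv q)
    (sub_ne_zero.1 (apply_add_sub_ne_zero hv0 q)) (f a)]
  rw [add_sub_cancel_left] at h2
  rw [← h2]
  refine (f.existsUnique_congr fun {r} => ?_).symm
  rw [hf, hf, hf]

theorem PreservesNull.minkForm_ne_zero_iff' (hf : PreservesNull f) {v w : Fin d → Q}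
    (hv : IsNull v) (hv0 : v ≠ 0) (p : Fin d → Q) :
    minkForm Q d (f (p + w) - f p) (f (p + v) - f p) ≠ 0 ↔ minkForm Q d w v ≠ 0 := by
  rw [hf.minkForm_ne_zero_iff hv hv0]; simp

/-- Parallel lightlike lines are mapped to parallel lines. -/
theorem PreservesNull.exists_smul (hf : PreservesNull f) {v : Fin d → Q} (hv : IsNull v)
    (hv0 : v ≠ 0) (p q : Fin d → Q) : ∃ t : Q, f (q + v) - f q = t • (f (p + v) - f p) := by
  refine (hf.isNull_sub hv p).exists_smul (hf.isNull_sub hv q) (apply_add_sub_ne_zero hv0 p) ?_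
  by_contra hB
  set v' := f (p + v) - f p with hv'
  set v'' := f (q + v) - f q with hv''
  -- The whole image line comes from the line through `p` along `v`, where pairing with `v` relative
  -- to `q` is constant. If `⟨v', v''⟩ ≠ 0`, the corresponding pairing on the image line takes both
  -- values `0` and `1`, a contradiction.
  have hpre : ∀ s : Q, ∃ t : Q, f.symm (f p + s • v') = p + t • v := by
    intro s
    set r := f.symm (f p + s • v') with hr
    have hfr : f r = f p + s • v' := by simp [hr]
    have h1 : IsNull (r - p) := by
      rw [← hf, hfr, add_sub_cancel_left]; exact (hf.isNull_sub hv p).smul s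
    have h2 : IsNull (r - p - v) := by
      rw [sub_sub, ← hf, hfr]
      have : f p + s • v' - f (p + v) = (s - 1) • v' := by rw [sub_smul, one_smul, hv']; abel
      rw [this]; exact (hf.isNull_sub hv p).smul _
    obtain ⟨t, ht⟩ := hv.exists_smul_of_sub h1 hv0 h2
    exact ⟨t, by rw [← ht]; abel⟩
  have key : ∀ s : Q, minkForm Q d (f p + s • v' - f q) v'' ≠ 0 ↔ minkForm Q d (p - q) v ≠ 0 := by
    intro s
    obtain ⟨t, ht⟩ := hpre s
    rw [Equiv.symm_apply_eq] at ht
    have e : p + t • v - q = (p - q) + t • v := by abel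
    rw [ht, hf.minkForm_ne_zero_iff hv hv0, e]
    rw [IsNull] at hv
    simp [hv]
  have e : ∀ s : Q, minkForm Q d (f p + s • v' - f q) v'' =
      minkForm Q d (f p - f q) v'' + s * minkForm Q d v' v'' := by
    intro s
    simp only [map_add, map_sub, map_smul, LinearMap.add_apply, LinearMap.sub_apply,
      LinearMap.smul_apply, smul_eq_mul]
    ring
  simp only [e] at key
  set b := minkForm Q d v' v''
  set c := minkForm Q d (f p - f q) v''
  have h1 := key (-c / b)
  have h2 := key ((1 - c) / b)
  rw [div_mul_cancel₀ _ hB] at h1 h2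
  have h3 : ¬ minkForm Q d (p - q) v ≠ 0 := fun h => h1.2 h (by ring)
  refine h3 (h2.1 ?_)
  simp

/-- A parallelogram with lightlike sides is mapped to a parallelogram. -/
theorem PreservesNull.parallelogram (hf : PreservesNull f) {v w : Fin d → Q} (hv : IsNull v)
    (hw : IsNull w) (h : minkForm Q d v w ≠ 0) (p : Fin d → Q) :
    f (p + w + v) - f (p + w) = f (p + v) - f p := by
  have hv0 : v ≠ 0 := by rintro rfl; simp at h
  have hw0 : w ≠ 0 := by rintro rfl; simp at h
  obtain ⟨s, hs⟩ := hf.exists_smul hv hv0 p (p + w)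
  obtain ⟨t, ht⟩ := hf.exists_smul hw hw0 p (p + v)
  rw [add_right_comm] at ht
  have hB := (hf.minkForm_ne_zero_iff' (w := v) hw hw0 p).2 h
  have hv' := hf.isNull_sub hv p
  have hv'0 := apply_add_sub_ne_zero (f := f) hv0 p
  set v' := f (p + v) - f p with hv'def
  set w' := f (p + w) - f p with hw'def
  -- The image quadrilateral closes up; pairing with the null `v'` then isolates `t - 1`.
  have e : (s - 1) • v' = (t - 1) • w' := by
    rw [sub_smul, sub_smul, ← hs, ← ht, one_smul, one_smul, hv'def, hw'def]; abel
  have e2 : (t - 1) * minkForm Q d v' w' = 0 := by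
    rw [← smul_eq_mul, ← map_smul, ← e, map_smul]
    rw [IsNull] at hv'
    simp [hv']
  have ht1 : t - 1 = 0 := (mul_eq_zero.1 e2).resolve_right hB
  rw [ht1, zero_smul, smul_eq_zero] at e
  have hs1 : s = 1 := sub_eq_zero.1 (e.resolve_right hv'0)
  rw [hs, hs1, one_smul]

/-- Two spatial coordinates equal to `±v 0` would already make the spatial sum at least `2 (v 0)²`.
The index found gives a plane in which neither null direction is orthogonal to `v`. -/
theorem IsNull.exists_sq_ne {v : Fin d → Q} (hd : 3 ≤ d) (hv : IsNull v) (hv0 : v ≠ 0) :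
    ∃ j : Fin d, j ≠ 0 ∧ v j ^ 2 ≠ v 0 ^ 2 := by
  have h0 : v 0 ≠ 0 := fun h0 => hv0 (hv.eq_zero h0)
  obtain ⟨i, j, hi, hj, hij⟩ := exists_two_spatial hd
  by_contra! h
  rw [IsNull, minkForm_self] at hv
  have hne : (⟨i, hi⟩ : {i : Fin d // i ≠ 0}) ≠ ⟨j, hj⟩ := fun h => hij (congrArg Subtype.val h)
  have := Finset.sum_le_sum_of_subset_of_nonneg
    (Finset.subset_univ ({⟨i, hi⟩, ⟨j, hj⟩} : Finset {i : Fin d // i ≠ 0}))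
    (f := fun i : {i : Fin d // i ≠ 0} => v i ^ 2) (fun i _ _ => sq_nonneg _)
  rw [Finset.sum_pair hne] at this
  simp only [h i hi, h j hj] at this
  have := pow_pos (abs_pos.2 h0) 2
  rw [sq_abs] at this
  linarith

theorem minkForm_single_add {i : Fin d} (hi : i ≠ 0) (v : Fin d → Q) (s t : Q) :
    minkForm Q d v (Pi.single 0 s + Pi.single i t) = v 0 * s - v i * t := by
  rw [map_add, minkForm_single_zero, minkForm_single hi]; ring

/-- The displacement of a lightlike vector does not depend on the base point. -/
theorem PreservesNull.sub_eq_sub (hd : 3 ≤ d) (hf : PreservesNull f) {v : Fin d → Q}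
    (hv : IsNull v) (p x : Fin d → Q) : f (p + x + v) - f (p + x) = f (p + v) - f p := by
  by_cases hv0 : v = 0
  · simp [hv0]
  -- Translations that leave the displacement along `v` unchanged form a group. It contains each
  -- null vector not orthogonal to `v`, and these suffice to generate.
  let S : AddSubgroup (Fin d → Q) :=
    { carrier := {x | ∀ p, f (p + x + v) - f (p + x) = f (p + v) - f p}
      zero_mem' := fun p => by simp
      add_mem' := fun {a b} ha hb p => by rw [← add_assoc, hb, ha]
      neg_mem' := fun {a} ha p => by
        have := ha (p + -a)
        rwa [neg_add_cancel_right, eq_comm] at this }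
  have hS : ∀ w, IsNull w → minkForm Q d v w ≠ 0 → w ∈ S := fun w hw h =>
    hf.parallelogram hv hw h
  have h0 : v 0 ≠ 0 := fun h0 => hv0 (hv.eq_zero h0)
  have hmem : ∀ i, i ≠ 0 → ∀ σ : Q, σ ^ 2 = 1 → v 0 ≠ σ * v i → ∀ t,
      (Pi.single 0 t + Pi.single i (σ * t) : Fin d → Q) ∈ S := by
    intro i hi σ hσ hne t
    by_cases ht : t = 0
    · simp [ht, S.zero_mem]
    refine hS _ (isNull_single_add hi t hσ) ?_
    rw [minkForm_single_add hi]
    have : v 0 * t - v i * (σ * t) = (v 0 - σ * v i) * t := by ring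
    rw [this]
    exact mul_ne_zero (sub_ne_zero.2 hne) ht
  obtain ⟨j, hj, hvj⟩ := hv.exists_sq_ne hd hv0
  refine mem_of_null_mem S (j := j) (fun t => ?_) (fun t => ?_) (fun i hi => ?_) x p
  · simpa using hmem j hj 1 (by norm_num) (fun h => hvj (by rw [h]; ring)) t
  · simpa using hmem j hj (-1) (by norm_num) (fun h => hvj (by rw [h]; ring)) t
  · by_cases h : v 0 = v i
    · refine ⟨-1, by norm_num, hmem i hi _ (by norm_num) fun h' => h0 ?_⟩
      linarith
    · exact ⟨1, by norm_num, hmem i hi _ (by norm_num) (by simpa using h)⟩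

theorem PreservesNull.map_add_sub (hd : 3 ≤ d) (hf : PreservesNull f) (p x : Fin d → Q) :
    f (p + x) - f p = f x - f 0 := by
  let S : AddSubgroup (Fin d → Q) :=
    { carrier := {x | ∀ p q, f (p + x) - f p = f (q + x) - f q}
      zero_mem' := fun p => by simp
      add_mem' := fun {a b} ha hb p q => by
        rw [← add_assoc, ← add_assoc, ← sub_add_sub_cancel (f (p + a + b)) (f (p + a)) (f p),
          ha p q, hb (p + a) (q + a), sub_add_sub_cancel]
      neg_mem' := fun {a} ha p q => by
        have := ha (p + -a) (q + -a)
        rw [neg_add_cancel_right, neg_add_cancel_right] at this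
        rw [← neg_sub, this, neg_sub] }
  have hS : ∀ w, IsNull w → w ∈ S := fun w hw p q => by
    have h1 := hf.sub_eq_sub hd hw 0 p
    have h2 := hf.sub_eq_sub hd hw 0 q
    rw [zero_add] at h1 h2
    rw [h1, h2]
  obtain ⟨j, -, hj, -, -⟩ := exists_two_spatial hd
  have hx := mem_of_null_mem S (j := j)
    (fun t => hS _ (by simpa using isNull_single_add hj t (σ := 1) (by norm_num)))
    (fun t => hS _ (by simpa using isNull_single_add hj t (σ := -1) (by norm_num)))
    (fun i hi => ⟨1, by norm_num, fun t => hS _ (isNull_single_add hi t (by norm_num))⟩) x p 0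
  rwa [zero_add] at hx

theorem PreservesNull.exists_addEquiv (hd : 3 ≤ d) (hf : PreservesNull f) :
    ∃ g : (Fin d → Q) ≃+ (Fin d → Q), (∀ x, IsNull (g x) ↔ IsNull x) ∧ ∀ x, f x = g x + f 0 := by
  refine ⟨{ f.trans (Equiv.subRight (f 0)) with
    map_add' := fun x y => ?_ }, fun x => ?_, fun x => ?_⟩
  · have := hf.map_add_sub hd x y
    simp only [Equiv.toFun_as_coe, Equiv.trans_apply, Equiv.subRight_apply]
    rw [← this]; abel
  · have := hf x 0
    rw [sub_zero] at this
    exact this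
  · simp

end Alexandrov

/-! ### Additive null-preserving bijections are semilinear. -/

section Semilinear

variable {Q : Type*} [Field Q] [LinearOrder Q] [IsStrictOrderedRing Q] {d : ℕ} [NeZero d]
  {g : (Fin d → Q) ≃+ (Fin d → Q)}

theorem minkForm_map_ne_zero (hg : ∀ x, IsNull (g x) ↔ IsNull x) {v w : Fin d → Q}
    (hv : IsNull v) (hw : IsNull w) (h : minkForm Q d v w ≠ 0) :
    minkForm Q d (g v) (g w) ≠ 0 := by
  intro h'
  have h1 := (hg v).2 hv
  have h2 := (hg w).2 hw
  have h3 : IsNull (g (v + w)) := by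
    rw [IsNull] at *
    rw [map_add, minkForm_add_self, h1, h2, h']; ring
  rw [hg, IsNull, minkForm_add_self] at h3
  rw [IsNull] at hv hw
  rw [hv, hw] at h3
  apply h
  linarith

theorem exists_map_smul_eq (hg : ∀ x, IsNull (g x) ↔ IsNull x) {v : Fin d → Q} (hv : IsNull v)
    (hv0 : v ≠ 0) (t : Q) : ∃ c : Q, g (t • v) = c • g v := by
  refine ((hg v).2 hv).exists_smul_of_sub ((hg _).2 (hv.smul t)) (by simpa using hv0) ?_
  rw [← map_sub, hg]
  have : t • v - v = (t - 1) • v := by rw [sub_smul, one_smul]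
  rw [this]; exact hv.smul _

/-- On the hyperbolic plane of `e₀` and `e_i`, the map is semilinear. -/
theorem exists_mul_of_spatial [IsEuclideanField Q] (hd : 3 ≤ d)
    (hg : ∀ x, IsNull (g x) ↔ IsNull x) {i : Fin d} (hi : i ≠ 0) :
    ∃ φ : Q → Q, (∀ s t, φ (s * t) = φ s * φ t) ∧
      (∀ t, g (Pi.single 0 t) = φ t • g (Pi.single 0 1)) ∧
      ∀ t, g (Pi.single i t) = φ t • g (Pi.single i 1) := by
  obtain ⟨j, hj, hji⟩ := exists_spatial_ne hd i
  set v : Fin d → Q := Pi.single 0 1 + Pi.single i 1 with hvdef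
  set w : Fin d → Q := Pi.single 0 1 + Pi.single i (-1) with hwdef
  have hv : IsNull v := by simpa using isNull_single_add hi (1 : Q) (σ := 1) (by norm_num)
  have hw : IsNull w := by simpa using isNull_single_add hi (1 : Q) (σ := -1) (by norm_num)
  have hvw : minkForm Q d v w = 2 := by
    rw [hwdef, minkForm_single_add hi]
    simp [hvdef, hi, hi.symm]
    norm_num
  have hv0 : v ≠ 0 := by rintro h; rw [h] at hvw; simp at hvw
  have hw0 : w ≠ 0 := by rintro h; rw [h] at hvw; simp at hvw
  have hT := minkForm_map_ne_zero hg hv hw (by rw [hvw]; norm_num)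
  choose α hα using exists_map_smul_eq hg hv hv0
  choose β hβ using exists_map_smul_eq hg hw hw0
  set T : Q → Q → Q := fun s t => minkForm Q d (g (s • v)) (g (t • w)) with hTdef
  have hTs : ∀ s t, T s t = α s * β t * minkForm Q d (g v) (g w) := fun s t => by
    simp only [hTdef, hα, hβ, map_smul, LinearMap.smul_apply, smul_eq_mul]; ring
  have hTneg : ∀ s t, T (-s) t = -T s t := fun s t => by simp [hTdef]
  have hTneg' : ∀ s t, T s (-t) = -T s t := fun s t => by simp [hTdef]
  -- Both `z + y` and `z - y` are null, with `y` along a third axis. Adding the two conditions on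
  -- their images shows that `T (a²) (b²)` depends only on `a * b`.
  have hTsq : ∀ a b : Q, 2 * T (a ^ 2) (b ^ 2) =
      -minkForm Q d (g (Pi.single j (2 * (a * b)))) (g (Pi.single j (2 * (a * b)))) := by
    intro a b
    set y : Fin d → Q := Pi.single j (2 * (a * b)) with hy
    set z : Fin d → Q := a ^ 2 • v + b ^ 2 • w with hz
    have hvj : v j = 0 := by simp [hvdef, hj, hji]
    have hwj : w j = 0 := by simp [hwdef, hj, hji]
    have hzy : minkForm Q d z y = 0 := by
      rw [hy, minkForm_single hj]; simp [hz, hvj, hwj]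
    have hyy : minkForm Q d y y = -(2 * (a * b)) ^ 2 := by
      rw [hy, minkForm_single hj]; simp [sq]
    have hzz : minkForm Q d z z = (2 * (a * b)) ^ 2 := by
      rw [IsNull] at hv hw
      rw [hz, minkForm_add_self]
      simp only [map_smul, LinearMap.smul_apply, hv, hw, hvw, smul_eq_mul]; ring
    have h1 : IsNull (g (z + y)) := by
      rw [hg, IsNull, minkForm_add_self, hzy, hyy, hzz]; ring
    have h2 : IsNull (g (z - y)) := by
      rw [hg, IsNull, minkForm_sub_self, hzy, hyy, hzz]; ring
    rw [IsNull, map_add, minkForm_add_self] at h1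
    rw [IsNull, map_sub, minkForm_sub_self] at h2
    have h3 : minkForm Q d (g z) (g z) = 2 * T (a ^ 2) (b ^ 2) := by
      have hv' := (hg _).2 (hv.smul (a ^ 2))
      have hw' := (hg _).2 (hw.smul (b ^ 2))
      rw [IsNull] at hv' hw'
      rw [hz, map_add, minkForm_add_self, hv', hw']
      simp [hTdef]
    linarith
  -- Square roots write nonnegative `s`, `t` as `a²`, `b²`; signs follow from additivity of `g`.
  have hpos : ∀ s t, 0 ≤ s → 0 ≤ t → T s t = T (s * t) 1 := by
    intro s t hs ht
    have h1 := hTsq (sqrt s) (sqrt t)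
    have h2 := hTsq (sqrt s * sqrt t) 1
    rw [mul_one, mul_pow, one_pow, sq_sqrt hs, sq_sqrt ht] at h2
    rw [sq_sqrt hs, sq_sqrt ht, ← h2] at h1
    exact mul_left_cancel₀ two_ne_zero h1
  have hall : ∀ s t, T s t = T (s * t) 1 := by
    have hall' : ∀ s t, 0 ≤ t → T s t = T (s * t) 1 := by
      intro s t ht
      rcases le_total 0 s with hs | hs
      · exact hpos s t hs ht
      · have := hpos (-s) t (neg_nonneg.2 hs) ht
        rwa [neg_mul, hTneg, hTneg, neg_inj] at this
    intro s t
    rcases le_total 0 t with ht | ht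
    · exact hall' s t ht
    · have := hall' s (-t) (neg_nonneg.2 ht)
      rwa [mul_neg, hTneg, hTneg', neg_inj] at this
  have hone : ∀ (γ : Q → Q) (x : Fin d → Q), x ≠ 0 → (∀ t, g (t • x) = γ t • g x) → γ 1 = 1 := by
    intro γ x hx h
    have h1 := h 1
    rw [one_smul] at h1
    have hgx : g x ≠ 0 := by simpa using hx
    exact smul_left_injective Q hgx (by simpa using h1.symm)
  have hα1 := hone α v hv0 hα
  have hβ1 := hone β w hw0 hβ
  have hmul : ∀ s t, α s * β t = α (s * t) := fun s t => by
    have := hall s t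
    rw [hTs, hTs, hβ1, mul_one] at this
    exact mul_right_cancel₀ hT this
  have hβα : ∀ t, β t = α t := fun t => by
    have := hmul 1 t
    rwa [hα1, one_mul, one_mul] at this
  have hsum : ∀ t : Q, (Pi.single 0 t : Fin d → Q) = (t / 2) • v + (t / 2) • w := fun t => by
    rw [hvdef, hwdef, ← smul_add, add_add_add_comm, ← Pi.single_add, ← Pi.single_add,
      add_neg_cancel, Pi.single_zero, add_zero, ← Pi.single_smul]
    congr 1; simp only [smul_eq_mul]; ring
  have hdiff : ∀ t : Q, (Pi.single i t : Fin d → Q) = (t / 2) • v - (t / 2) • w := fun t => by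
    rw [hvdef, hwdef, ← smul_sub, add_sub_add_left_eq_sub, ← Pi.single_sub, ← Pi.single_smul]
    congr 1; simp only [smul_eq_mul]; ring
  have hhalf : ∀ t, α (t / 2) = α t * α (1 / 2) := fun t => by
    rw [← hβα (1 / 2), hmul]; congr 1; ring
  refine ⟨α, fun s t => by rw [← hmul, hβα], fun t => ?_, fun t => ?_⟩
  · rw [hsum t, hsum 1, map_add, map_add, hα, hβ, hα, hβ, hβα, hβα, hhalf, ← smul_add, ← smul_add,
      mul_smul]
  · rw [hdiff t, hdiff 1, map_sub, map_sub, hα, hβ, hα, hβ, hβα, hβα, hhalf, ← smul_sub, ← smul_sub,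
      mul_smul]

/-- The multipliers obtained from the different planes agree because all the planes share the time
axis. -/
theorem exists_ringEquiv [IsEuclideanField Q] (hd : 3 ≤ d) (hg : ∀ x, IsNull (g x) ↔ IsNull x) :
    ∃ φ : Q ≃+* Q, ∀ (t : Q) (x : Fin d → Q), g (t • x) = φ t • g x := by
  choose! φ hmul h0 hs using fun i => exists_mul_of_spatial (i := i) hd hg
  obtain ⟨i, j, hi, -⟩ := exists_two_spatial hd
  have hgne : g (Pi.single 0 1) ≠ 0 := by simp
  have hinj : ∀ a b : Q, a • g (Pi.single 0 1) = b • g (Pi.single 0 1) → a = b := fun a b h =>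
    smul_left_injective Q hgne h
  have hφ : ∀ k, k ≠ 0 → φ k = φ i := fun k hk => by
    funext t
    exact hinj _ _ (by rw [← h0 k hk, ← h0 i hi])
  have hsing : ∀ k t, g (Pi.single k t) = φ i t • g (Pi.single k 1) := fun k t => by
    by_cases hk : k = 0
    · rw [hk, h0 i hi]
    · rw [hs k hk, hφ k hk]
  let S : AddSubgroup (Fin d → Q) :=
    { carrier := {x | ∀ t, g (t • x) = φ i t • g x}
      zero_mem' := fun t => by simp
      add_mem' := fun {a b} ha hb t => by rw [smul_add, map_add, ha, hb, map_add, smul_add]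
      neg_mem' := fun {a} ha t => by rw [smul_neg, map_neg, ha, map_neg, smul_neg] }
  have hsemi : ∀ x t, g (t • x) = φ i t • g x := mem_of_forall_single S fun k s t => by
    rw [← Pi.single_smul, smul_eq_mul, hsing, hsing k s, hmul i hi, mul_smul]
  have hsurj : Function.Surjective (φ i) := by
    intro c
    set v : Fin d → Q := Pi.single 0 1 + Pi.single i 1 with hvdef
    have hv : IsNull v := by simpa using isNull_single_add hi (1 : Q) (σ := 1) (by norm_num)
    have hv0 : v ≠ 0 := fun h => by
      have := congrFun h 0
      simp [hvdef, hi.symm] at this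
    have hv0' : g v ≠ 0 := by simpa using hv0
    have hv' := (hg v).2 hv
    -- Since `g.symm` also preserves nullity, the preimage of `c • g v` lies on the line of `v`.
    obtain ⟨t, ht⟩ := hv.exists_smul_of_sub (w := g.symm (c • g v))
      (by rw [← hg, AddEquiv.apply_symm_apply]; exact hv'.smul c) hv0 (by
        rw [← hg, map_sub, AddEquiv.apply_symm_apply]
        have : c • g v - g v = (c - 1) • g v := by rw [sub_smul, one_smul]
        rw [this]; exact hv'.smul _)
    rw [AddEquiv.symm_apply_eq, hsemi] at ht
    exact ⟨t, (smul_left_injective Q hv0' ht).symm⟩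
  let ψ : Q →+* Q :=
    { toFun := φ i
      map_one' := hinj _ _ (by rw [← hsemi, one_smul, one_smul])
      map_zero' := hinj _ _ (by rw [← hsemi, zero_smul, zero_smul, map_zero])
      map_mul' := hmul i hi
      map_add' := fun s t => hinj _ _ (by
        rw [← hsemi, add_smul, add_smul, map_add, hsemi, hsemi]) }
  exact ⟨RingEquiv.ofBijective ψ ⟨ψ.injective, hsurj⟩, fun t x => hsemi x t⟩

variable (d) in
/-- The map of tuples induced by a field automorphism. -/
def coordMap (φ : Q ≃+* Q) : (Fin d → Q) ≃+ (Fin d → Q) where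
  toFun x i := φ (x i)
  invFun x i := φ.symm (x i)
  left_inv x := by simp
  right_inv x := by simp
  map_add' x y := by ext; simp

@[simp]
theorem coordMap_apply (φ : Q ≃+* Q) (x : Fin d → Q) (i : Fin d) : coordMap d φ x i = φ (x i) := rfl

@[simp]
theorem coordMap_symm_apply (φ : Q ≃+* Q) (x : Fin d → Q) (i : Fin d) :
    (coordMap d φ).symm x i = φ.symm (x i) := rfl

theorem minkForm_coordMap (φ : Q ≃+* Q) (x y : Fin d → Q) :
    minkForm Q d (coordMap d φ x) (coordMap d φ y) = φ (minkForm Q d x y) := by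
  simp [minkForm_apply]

/-- Undoing `φ` coordinatewise makes `g` linear; the cone survives because the form has coefficients
`±1`, fixed by `φ`. -/
theorem exists_linearEquiv [IsEuclideanField Q] (hd : 3 ≤ d)
    (hg : ∀ x, IsNull (g x) ↔ IsNull x) :
    ∃ (φ : Q ≃+* Q) (L : (Fin d → Q) ≃ₗ[Q] (Fin d → Q)), (∀ x, IsNull (L x) ↔ IsNull x) ∧
      ∀ x, g x = L (coordMap d φ x) := by
  obtain ⟨φ, hφ⟩ := exists_ringEquiv hd hg
  refine ⟨φ, { (coordMap d φ).symm.trans g with map_smul' := fun c x => ?_ }, fun x => ?_,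
    fun x => ?_⟩
  · have : (coordMap d φ).symm (c • x) = φ.symm c • (coordMap d φ).symm x := by ext; simp
    simp [this, hφ]
  · obtain ⟨y, rfl⟩ := (coordMap d φ).surjective x
    have h := hg y
    simp only [IsNull] at h
    simp only [IsNull, minkForm_coordMap, map_eq_zero_iff φ φ.injective]
    simpa using h
  · simp

end Semilinear

/-! ### Linear bijections preserving the light cone. -/

section Linear

variable {Q : Type*} [Field Q] [LinearOrder Q] [IsStrictOrderedRing Q] {d : ℕ} [NeZero d]
  {L : (Fin d → Q) ≃ₗ[Q] (Fin d → Q)}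

/-- A linear bijection preserving the light cone is a similarity of the Minkowski form. -/
theorem exists_similarity (hd : 3 ≤ d) (hL : ∀ x, IsNull (L x) ↔ IsNull x) :
    ∃ c : Q, 0 < c ∧ ∀ x, minkForm Q d (L x) (L x) = c * minkForm Q d x x := by
  set T : (Fin d → Q) →ₗ[Q] (Fin d → Q) →ₗ[Q] Q :=
    (minkForm Q d).compl₁₂ L.toLinearMap L.toLinearMap with hT
  have hTa : ∀ x y, T x y = minkForm Q d (L x) (L y) := fun x y => rfl
  set e : Fin d → Fin d → Q := fun i => Pi.single i 1 with he
  set c := T (e 0) (e 0) with hc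
  have hcomm : ∀ x y, T x y = T y x := fun x y => by rw [hTa, hTa, minkForm_comm]
  have hnull : ∀ x, IsNull x → T x x = 0 := fun x hx => (hL x).2 hx
  have hpm : ∀ i, i ≠ 0 → T (e 0) (e i) = 0 ∧ T (e i) (e i) = -c := by
    intro i hi
    have h1 := hnull _ (isNull_single_add hi (1 : Q) (σ := 1) (by norm_num))
    have h2 := hnull _ (isNull_single_add hi (1 : Q) (σ := -1) (by norm_num))
    rw [mul_one, Pi.single_neg] at h2
    rw [mul_one] at h1
    change T (e 0 + e i) (e 0 + e i) = 0 at h1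
    change T (e 0 + -e i) (e 0 + -e i) = 0 at h2
    simp only [map_add, map_neg, LinearMap.add_apply, LinearMap.neg_apply,
      hcomm (e i) (e 0)] at h1 h2
    constructor <;> linarith
  have hij : ∀ i j, i ≠ 0 → j ≠ 0 → i ≠ j → T (e i) (e j) = 0 := by
    intro i j hi hj hne
    -- The triple `5² = 3² + 4²` gives a null vector in which the cross term of `e i` and `e j`
    -- appears.
    have hn : IsNull ((5 : Q) • e 0 + (3 : Q) • e i + (4 : Q) • e j) := by
      rw [IsNull, minkForm_add_self, minkForm_add_self]
      simp only [map_smul, LinearMap.smul_apply, he, minkForm_single_zero, minkForm_single hi,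
        minkForm_single hj, smul_eq_mul, map_add, LinearMap.add_apply]
      simp [hi, hj, hne.symm]
      norm_num
    have h1 := hnull _ hn
    simp only [map_add, map_smul, LinearMap.add_apply, LinearMap.smul_apply, smul_eq_mul,
      hcomm (e i) (e 0), hcomm (e j) (e 0), hcomm (e j) (e i), (hpm i hi).1, (hpm j hj).1,
      (hpm i hi).2, (hpm j hj).2, ← hc] at h1
    linarith
  have hTc : T = c • minkForm Q d := by
    refine LinearMap.ext_basis (Pi.basisFun Q (Fin d)) (Pi.basisFun Q (Fin d)) fun i j => ?_
    rw [Pi.basisFun_apply, Pi.basisFun_apply]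
    change T (e i) (e j) = c * minkForm Q d (e i) (e j)
    by_cases hj : j = 0
    · subst hj
      rw [he, minkForm_single_zero]
      by_cases hi : i = 0
      · subst hi; simp [hc, he]
      · rw [hcomm]; simpa [hi, Ne.symm hi] using (hpm i hi).1
    · rw [he, minkForm_single hj]
      by_cases hi : i = 0
      · subst hi; simpa [hj] using (hpm j hj).1
      · by_cases h : i = j
        · subst h; simpa using (hpm i hi).2
        · simpa [h, Ne.symm h] using hij i j hi hj h
  have hform : ∀ x, minkForm Q d (L x) (L x) = c * minkForm Q d x x := fun x => by
    rw [← hTa, hTc]; rfl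
  refine ⟨c, ?_, hform⟩
  obtain ⟨i, j, hi, hj, hne⟩ := exists_two_spatial hd
  by_contra hneg
  have hc0 : c ≠ 0 := fun h => by
    have h1 : IsNull (L (e 0)) := h
    rw [hL, IsNull, he, minkForm_single_zero] at h1
    simp at h1
  have hcneg : c < 0 := lt_of_le_of_ne (not_lt.1 hneg) hc0
  -- If `c < 0`, nonzero vectors of this spatial plane have images of positive square, hence of
  -- nonzero time component. But a linear functional on a plane has a nontrivial kernel.
  have key : ∀ a b : Q, L (a • e i + b • e j) 0 = 0 → a = 0 ∧ b = 0 := by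
    intro a b h
    have h1 := minkForm_self_nonpos h
    have h2 : minkForm Q d (a • e i + b • e j) (a • e i + b • e j) = -(a ^ 2 + b ^ 2) := by
      rw [minkForm_add_self]
      simp only [map_smul, LinearMap.smul_apply, he, minkForm_single hi, minkForm_single hj,
        smul_eq_mul]
      simp [hne.symm]
      ring
    rw [hform, h2] at h1
    have h3 : a ^ 2 + b ^ 2 ≤ 0 := by
      by_contra h4
      have := mul_pos (neg_pos.2 hcneg) (not_le.1 h4)
      linarith
    constructor <;> refine pow_eq_zero_iff two_ne_zero |>.1 (le_antisymm ?_ (sq_nonneg _)) <;>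
      linarith [sq_nonneg a, sq_nonneg b]
  have h1 := key (L (e j) 0) (-(L (e i) 0)) (by simp; ring)
  have h2 := key 1 0 (by simpa using h1.2)
  exact one_ne_zero h2.1

end Linear

/-! ### The Alexandrov–Zeeman decomposition and Poincaré maps. -/

section Alexandrov

variable {Q : Type*} [Field Q] [LinearOrder Q] [IsStrictOrderedRing Q] [IsEuclideanField Q]
  {d : ℕ} [NeZero d]

/-- The Alexandrov–Zeeman theorem over Euclidean fields. -/
theorem PreservesNull.exists_decomposition (hd : 3 ≤ d) {f : (Fin d → Q) ≃ (Fin d → Q)}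
    (hf : PreservesNull f) :
    ∃ (φ : Q ≃+* Q) (L : (Fin d → Q) ≃ₗ[Q] (Fin d → Q)) (c : Q), 0 < c ∧
      (∀ x, minkForm Q d (L x) (L x) = c * minkForm Q d x x) ∧
      ∀ x, f x = L (coordMap d φ x) + f 0 := by
  obtain ⟨g, hg, hfg⟩ := hf.exists_addEquiv hd
  obtain ⟨φ, L, hL, hgL⟩ := exists_linearEquiv hd hg
  obtain ⟨c, hc, hLc⟩ := exists_similarity hd hL
  exact ⟨φ, L, c, hc, hLc, fun x => by rw [hfg, hgL]⟩

theorem euclLength_sq {ι : Type*} [Fintype ι] (p : ι → Q) : euclLength p ^ 2 = ∑ i, p i ^ 2 :=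
  sq_sqrt (Finset.sum_nonneg fun _ _ => sq_nonneg _)

theorem euclLength_nonneg {ι : Type*} [Fintype ι] (p : ι → Q) : 0 ≤ euclLength p :=
  sqrt_nonneg _

theorem euclLength_spaceComp_sub_sq (p q : Fin d → Q) :
    euclLength (spaceComp p - spaceComp q) ^ 2 =
      (timeComp p - timeComp q) ^ 2 - minkForm Q d (p - q) (p - q) := by
  rw [euclLength_sq, minkForm_self]
  simp [spaceComp, timeComp]

theorem euclLength_eq_abs_iff (p q : Fin d → Q) :
    euclLength (spaceComp p - spaceComp q) = |timeComp p - timeComp q| ↔ IsNull (p - q) := by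
  rw [← sq_eq_sq₀ (euclLength_nonneg _) (abs_nonneg _), sq_abs, euclLength_spaceComp_sub_sq,
    sub_eq_self, IsNull]

theorem minkLength_eq (x : Fin d → Q) :
    minkLength x = if 0 ≤ minkForm Q d x x then sqrt (minkForm Q d x x)
      else -sqrt (-minkForm Q d x x) := by
  have h : minkForm Q d x x = timeComp x ^ 2 - euclLength (spaceComp x) ^ 2 := by
    rw [euclLength_sq, minkForm_self]; rfl
  rw [minkLength, h, neg_sub]
  simp only [sub_nonneg]

theorem isPoincare_of_minkForm (L : (Fin d → Q) ≃ₗ[Q] (Fin d → Q)) (a : Fin d → Q)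
    (hL : ∀ x, minkForm Q d (L x) (L x) = minkForm Q d x x) : IsPoincare fun x => L x + a := by
  refine ⟨⟨L.toAffineEquiv.trans (AffineEquiv.constVAdd Q (Fin d → Q) a), fun p => ?_⟩,
    fun p q => ?_⟩
  · simp [add_comm]
  · rw [minkDist, minkDist, add_sub_add_right_eq_sub, ← map_sub, minkLength_eq, minkLength_eq, hL]

theorem isPoincare_of_similarity {L : (Fin d → Q) ≃ₗ[Q] (Fin d → Q)} {c : Q} (hc : 0 < c)
    (a : Fin d → Q) (hL : ∀ x, minkForm Q d (L x) (L x) = c * minkForm Q d x x) :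
    ∃ P D : (Fin d → Q) → (Fin d → Q), IsPoincare P ∧ IsDilation D ∧
      ∀ x, L x + a = P (D x) := by
  have hs : sqrt c ≠ 0 := fun h => by
    have := sq_sqrt hc.le
    rw [h, zero_pow two_ne_zero] at this
    exact hc.ne this
  -- Dividing `L` by `√c` divides the form of its values by `c`.
  refine ⟨fun x => L.trans (LinearEquiv.smulOfNeZero Q (Fin d → Q) (sqrt c)⁻¹
      (inv_ne_zero hs)) x + a,
    fun x => sqrt c • x, isPoincare_of_minkForm _ a fun x => ?_,
    ⟨sqrt c, lt_of_le_of_ne (sqrt_nonneg c) hs.symm, fun _ => rfl⟩, fun x => ?_⟩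
  · simp only [LinearEquiv.trans_apply, LinearEquiv.smulOfNeZero_apply, map_smul,
      LinearMap.smul_apply, smul_eq_mul, hL]
    rw [← mul_assoc, ← mul_inv, ← sq, sq_sqrt hc.le, inv_mul_cancel_left₀ hc.ne']
  · simp [hs]

/-- Two time components vanish simultaneously on a nonzero vector. -/
theorem exists_ne_zero_time_eq_zero (hd : 3 ≤ d) (L : (Fin d → Q) ≃ₗ[Q] (Fin d → Q)) :
    ∃ y : Fin d → Q, y ≠ 0 ∧ y 0 = 0 ∧ L y 0 = 0 := by
  obtain ⟨i, j, hi, hj, hij⟩ := exists_two_spatial hd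
  by_cases h : L (Pi.single i 1) 0 = 0
  · exact ⟨Pi.single i 1, by simp, by simp [hi.symm], h⟩
  · refine ⟨L (Pi.single j 1) 0 • Pi.single i 1 - L (Pi.single i 1) 0 • Pi.single j 1,
      fun h' => h ?_, ?_, ?_⟩
    · have := congrFun h' j
      simpa [hij.symm] using this
    · simp [hi.symm, hj.symm]
    · rw [map_sub, map_smul, map_smul]
      simp [mul_comm]

/-- Comparing squares at `t + 1` and at `t` leaves `2 φ(t) = 2t`, so no sign choice remains. -/
theorem ringEquiv_eq_self_of_sq {φ : Q ≃+* Q} (h : ∀ t, φ t ^ 2 = t ^ 2) (t : Q) : φ t = t := by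
  have h1 := h (t + 1)
  rw [map_add, map_one, add_sq, add_sq, h t] at h1
  linarith

end Alexandrov

/-! ### From the axioms to null-preserving bijections. -/

namespace Model

variable {Q : Type*} [Field Q] [LinearOrder Q] [IsStrictOrderedRing Q] [IsEuclideanField Q]
  {d : ℕ} [NeZero d] {B : Type*} {M : Model Q d B}

theorem AxPh0.isNull_iff (hPh : M.AxPh0) {m : B} (hm : m ∈ M.IOb) (p q : Fin d → Q) :
    IsNull (p - q) ↔ M.Ph ∩ M.ev m p ∩ M.ev m q ≠ ∅ := by
  rw [← hPh m hm, euclLength_eq_abs_iff]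

theorem AxPh0.mem_Cd (hPh : M.AxPh0) {m : B} (hm : m ∈ M.IOb) (p : Fin d → Q) : p ∈ M.Cd m := by
  have h := (hPh.isNull_iff hm p p).1 (by rw [sub_self]; exact isNull_zero)
  rw [← Set.nonempty_iff_ne_empty] at h
  obtain ⟨b, hb⟩ := h
  exact Set.nonempty_iff_ne_empty.1 ⟨b, hb.2⟩

/-- Points with equal events are null-related to the same points, so their difference is null and
orthogonal to every null vector, hence zero. -/
theorem AxPh0.ev_injective (hd : 3 ≤ d) (hPh : M.AxPh0) {m : B} (hm : m ∈ M.IOb) :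
    Function.Injective (M.ev m) := by
  intro p q h
  have key : ∀ r, IsNull (p - r) ↔ IsNull (q - r) := fun r => by
    rw [hPh.isNull_iff hm, hPh.isNull_iff hm, h]
  obtain ⟨i, j, hi, hj, hij⟩ := exists_two_spatial hd
  have hpq : IsNull (p - q) := (key q).2 (by rw [sub_self]; exact isNull_zero)
  have horth : ∀ n, IsNull n → minkForm Q d (p - q) n = 0 := fun n hn => by
    have h1 := (key (q + n)).2 (by simpa using hn.neg)
    rw [← sub_sub, IsNull, minkForm_sub_self] at h1
    rw [IsNull] at hpq hn
    rw [hpq, hn] at h1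
    linarith
  refine sub_eq_zero.1 (hpq.eq_zero ?_)
  have h1 := horth _ (isNull_single_add hi (1 : Q) (σ := 1) (by norm_num))
  have h2 := horth _ (isNull_single_add hi (1 : Q) (σ := -1) (by norm_num))
  rw [minkForm_single_add hi] at h1 h2
  linarith

theorem AxPh0.isCrd (hd : 3 ≤ d) (hPh : M.AxPh0) {m : B} (hm : m ∈ M.IOb) (p : Fin d → Q) :
    M.IsCrd m (M.ev m p) p :=
  ⟨⟨hPh.mem_Cd hm p, rfl⟩, fun _ _ h => hPh.ev_injective hd hm h⟩

theorem AxPh0.eq_of_isCrd (hd : 3 ≤ d) (hPh : M.AxPh0) {m : B} (hm : m ∈ M.IOb)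
    {p q : Fin d → Q} (h : M.IsCrd m (M.ev m p) q) : q = p :=
  hPh.ev_injective hd hm h.1.2

theorem exists_ev_eq (hPh : M.AxPh0) (hEv : M.AxEv) {m k : B} (hm : m ∈ M.IOb)
    (hk : k ∈ M.IOb) (q : Fin d → Q) : ∃ p, M.ev m p = M.ev k q := by
  have : M.ev k q ∈ M.Ev k := ⟨q, hPh.mem_Cd hk q, rfl⟩
  rw [← hEv m hm k hk] at this
  obtain ⟨p, -, hp⟩ := this
  exact ⟨p, hp⟩

theorem exists_worldView_equiv (hd : 3 ≤ d) (hPh : M.AxPh0) (hEv : M.AxEv) {m k : B}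
    (hm : m ∈ M.IOb) (hk : k ∈ M.IOb) :
    ∃ f : (Fin d → Q) ≃ (Fin d → Q), PreservesNull f ∧ (∀ q, M.ev m (f q) = M.ev k q) ∧
      ∀ q p, M.worldView k m q p ↔ p = f q := by
  choose f hf using exists_ev_eq (M := M) hPh hEv hm hk
  choose f' hf' using exists_ev_eq (M := M) hPh hEv hk hm
  refine ⟨⟨f, f', fun q => hPh.ev_injective hd hk (by rw [hf', hf]),
    fun p => hPh.ev_injective hd hm (by rw [hf, hf'])⟩, fun p q => ?_, hf, fun q p => ?_⟩
  · rw [hPh.isNull_iff hm, hPh.isNull_iff hk, Equiv.coe_fn_mk, hf, hf]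
  · refine ⟨fun h => hPh.ev_injective hd hm ?_, ?_⟩
    · rw [← h.2.2]; exact (hf q).symm
    · rintro rfl
      exact ⟨hPh.mem_Cd hk q, hPh.mem_Cd hm _, (hf q).symm⟩

/-- Under `AxSimDist`, points simultaneous for both observers have the same Minkowski interval. -/
theorem AxSimDist.minkForm_eq (hd : 3 ≤ d) (hPh : M.AxPh0) (hSim : M.AxSimDist) {m k : B}
    (hm : m ∈ M.IOb) (hk : k ∈ M.IOb) {p₁ p₂ q₁ q₂ : Fin d → Q}
    (h₁ : M.ev m p₁ = M.ev k q₁) (h₂ : M.ev m p₂ = M.ev k q₂) (hp : p₁ 0 = p₂ 0)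
    (hq : q₁ 0 = q₂ 0) :
    minkForm Q d (p₁ - p₂) (p₁ - p₂) = minkForm Q d (q₁ - q₂) (q₁ - q₂) := by
  have hkm : ∀ {p q}, M.ev m p = M.ev k q → M.ev k q ∈ M.Ev m ∩ M.Ev k := fun {p q} h =>
    ⟨⟨p, hPh.mem_Cd hm p, h⟩, ⟨q, hPh.mem_Cd hk q, rfl⟩⟩
  obtain ⟨r, ⟨a₁, a₂, ha₁, ha₂, hr⟩, b₁, b₂, hb₁, hb₂, hr'⟩ :=
    hSim m hm k hk _ (hkm h₁) _ (hkm h₂)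
      ⟨p₁, p₂, h₁ ▸ hPh.isCrd hd hm p₁, h₂ ▸ hPh.isCrd hd hm p₂, hp⟩
      ⟨q₁, q₂, hPh.isCrd hd hk q₁, hPh.isCrd hd hk q₂, hq⟩
  rw [← h₁] at ha₁
  rw [← h₂] at ha₂
  rw [hPh.eq_of_isCrd hd hm ha₁, hPh.eq_of_isCrd hd hm ha₂] at hr
  rw [hPh.eq_of_isCrd hd hk hb₁, hPh.eq_of_isCrd hd hk hb₂] at hr'
  have h := congrArg (· ^ 2) (hr.symm.trans hr')
  simp only [euclLength_spaceComp_sub_sq, timeComp, hp, hq, sub_self] at h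
  linarith

end Model

end SpecRel

theorem mainTheorem5 {Q : Type*} [Field Q] [LinearOrder Q] [IsStrictOrderedRing Q]
    [SpecRel.IsEuclideanField Q] {B : Type*} (d : ℕ) [NeZero d] (hd : 3 ≤ d)
    (M : SpecRel.Model Q d B) (m k : B) (hm : m ∈ M.IOb) (hk : k ∈ M.IOb)
    (hPh : M.AxPh0) (hEv : M.AxEv) :
    (∃ P D F : (Fin d → Q) → (Fin d → Q),
      SpecRel.IsPoincare P ∧ SpecRel.IsDilation D ∧ SpecRel.IsFieldAutInduced F ∧
        ∀ q p, M.worldView k m q p ↔ p = P (D (F q))) ∧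
    (M.AxSimDist →
      ∃ P : (Fin d → Q) → (Fin d → Q), SpecRel.IsPoincare P ∧
        ∀ q p, M.worldView k m q p ↔ p = P q) := by
  obtain ⟨f, hf, hev, hw⟩ := SpecRel.Model.exists_worldView_equiv hd hPh hEv hm hk
  obtain ⟨φ, L, c, hc, hLc, hfL⟩ := hf.exists_decomposition hd
  refine ⟨?_, fun hSim => ?_⟩
  · obtain ⟨P, D, hP, hD, hPD⟩ := SpecRel.isPoincare_of_similarity hc (f 0) hLc
    exact ⟨P, D, SpecRel.coordMap d φ, hP, hD, ⟨φ, fun _ _ => rfl⟩, fun q p => by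
      rw [hw, hfL, hPD]⟩
  -- Pulling `y` back by `φ` yields a line `t • x` of points simultaneous with the origin for `k`,
  -- whose images under `f` are simultaneous with `f 0` for `m`.
  · obtain ⟨y, hy0, hyt, hLyt⟩ := SpecRel.exists_ne_zero_time_eq_zero hd L
    obtain ⟨x, rfl⟩ := (SpecRel.coordMap d φ).surjective y
    have hxt : x 0 = 0 := by simpa using hyt
    have hx0 : x ≠ 0 := by rintro rfl; simp at hy0
    have hNx : SpecRel.minkForm Q d x x ≠ 0 := fun h => hx0 (SpecRel.IsNull.eq_zero h hxt)
    have hcoord : ∀ t : Q, SpecRel.coordMap d φ (t • x) = φ t • SpecRel.coordMap d φ x := by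
      intro t; ext; simp
    have key : ∀ t : Q, φ t ^ 2 * (c * φ (SpecRel.minkForm Q d x x)) =
        t ^ 2 * SpecRel.minkForm Q d x x := by
      intro t
      have h := hSim.minkForm_eq hd hPh hm hk (hev (t • x)) (hev 0)
        (by rw [hfL (t • x), hcoord, map_smul]; simp [hLyt]) (by simp [hxt])
      rw [hfL (t • x), add_sub_cancel_right, sub_zero, hLc, SpecRel.minkForm_coordMap] at h
      simp only [map_smul, LinearMap.smul_apply, smul_eq_mul, map_mul] at h
      linear_combination h
    -- The case `t = 1` cancels the constant `c φ(⟨x, x⟩)` from the others, leaving `φ(t)² = t²`.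
    have h1 := key 1
    rw [map_one, one_pow, one_mul, one_mul] at h1
    have hφ : ∀ t, φ t = t := SpecRel.ringEquiv_eq_self_of_sq fun t =>
      mul_right_cancel₀ hNx (by rw [← key t, h1])
    rw [hφ] at h1
    have hc1 : c = 1 := mul_right_cancel₀ hNx (by rw [h1, one_mul])
    have hid : ∀ q : Fin d → Q, SpecRel.coordMap d φ q = q := fun q => by
      ext i; rw [SpecRel.coordMap_apply, hφ]
    exact ⟨fun x => L x + f 0, SpecRel.isPoincare_of_minkForm L (f 0) fun x => by
      rw [hLc, hc1, one_mul], fun q p => by rw [hw, hfL, hid]⟩
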